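/- Let $0\le N\le M$ be integers and let $a,b,c,d,e,f,t\in\mathbb C$ satisfy $cd+af=0$, $tcd+be=0$ and $c,d\neq0$. For a particle configuration $x=(1\le x_1<\dots<x_N\le M)$ and variables $u_1,\dots,u_N$ put $$G_x(u_1,\dots,u_N)=\prod_{j=1}^N\frac{(1-t)cu_j(au_j+b)^M}{eu_j+f}\prod_{1\le j<k\le N}\frac{tu_j-u_k}{u_j-u_k}\sum_{\sigma\in S_N}\ \prod_{\substack{1\le j<k\le N\\ \sigma(j)>\sigma(k)}}\frac{u_{\sigma(k)}-tu_{\sigma(j)}}{tu_{\sigma(k)}-u_{\sigma(j)}}\prod_{j=1}^N\Big(\frac{eu_{\sigma(j)}+f}{au_{\sigma(j)}+b}\Big)^{x_j},$$ and for a hole configuration $\overline x=(1\le\overline{x_1}<\dots<\overline{x_L}\le M)$ and variables $u_1,\dots,u_L$ put $$H_{\overline x}(u_1,\dots,u_L)=\prod_{j=1}^L\frac{(1-t)cu_j(atu_j+b)^M}{eu_j+tf}\prod_{1\le j<k\le L}\frac{u_j-tu_k}{t(u_j-u_k)}\sum_{\sigma\in S_L}\ \prod_{\substack{1\le j<k\le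 L\\ \sigma(j)>\sigma(k)}}\frac{tu_{\sigma(k)}-u_{\sigma(j)}}{u_{\sigma(k)}-tu_{\sigma(j)}}\prod_{j=1}^L\Big(\frac{eu_{\sigma(j)}+tf}{atu_{\sigma(j)}+b}\Big)^{\overline{x_j}}.$$ **Theorem (pairing formula).** Let $u_1,\dots,u_M\in\mathbb C$ be pairwise distinct and such that none of the denominators in the definitions of $H_{\overline x}(u_1,\dots,u_{M-N})$ and $G_x(u_{M-N+1},\dots,u_M)$ vanishes. Then $$\sum_x H_{\overline x}(u_1,\dots,u_{M-N})\,G_x(u_{M-N+1},\dots,u_M)=\frac{\det\Big((au_j+b)^M(-f)^k(eu_j+f)^{M-k}-(eu_j+f)^M(-b)^k(au_j+b)^{M-k}\Big)_{1\le j,k\le M}}{c^{M(M-1)/2}\,d^{M(M+1)/2}\,\prod_{1\le j<k\le M}(u_j-u_k)},$$ where the sum is over all configurations $x=(1\le x_1<\dots<x_N\le M)$ and $\overline x=(\overline{x_1}<\dots<\overline{x_{M-N}})$ is the complement of $x$ in $\{1,\dots,M\}$. -/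

import Mathlib

noncomputable section

/-- Configurations of `N` particles on the `M` sites `1, …, M`; the element `i : Fin M` stands for
the site `i + 1`. -/
abbrev ParticleConfig (M N : ℕ) : Type := {s : Finset (Fin M) // s.card = N}

/-- The positions `1 ≤ x₁ < x₂ < ⋯ < x_N ≤ M` of a configuration, listed in increasing order. -/
def ParticleConfig.pos {M N : ℕ} (x : ParticleConfig M N) (j : Fin N) : ℕ :=
  (x.1.orderEmbOfFin x.2 j : ℕ) + 1

/-- The complementary configuration (the holes of `x`). -/
def ParticleConfig.holes {M N : ℕ} (x : ParticleConfig M N) : ParticleConfig M (M - N) :=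
  ⟨x.1ᶜ, by rw [Finset.card_compl, x.2, Fintype.card_fin]⟩

/-- The pairs `(j, k)` of indices with `j < k`. -/
def ltPairs (n : ℕ) : Finset (Fin n × Fin n) :=
  Finset.univ.filter fun p => p.1 < p.2

/-- The pairs `(j, k)` of indices with `j < k` and `σ j > σ k`. -/
def inversionPairs {n : ℕ} (σ : Equiv.Perm (Fin n)) : Finset (Fin n × Fin n) :=
  Finset.univ.filter fun p => p.1 < p.2 ∧ σ p.2 < σ p.1

/-- `G_x(u₁, …, u_N)` on `M` sites, for the parameters `a, b, c, e, f, t`. -/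
def symG (a b c e f t : ℂ) (M : ℕ) {N : ℕ} (x : Fin N → ℕ) (u : Fin N → ℂ) : ℂ :=
  (∏ j, (1 - t) * c * u j * (a * u j + b) ^ M / (e * u j + f)) *
  (∏ p ∈ ltPairs N, (t * u p.1 - u p.2) / (u p.1 - u p.2)) *
  ∑ σ : Equiv.Perm (Fin N),
    (∏ p ∈ inversionPairs σ,
      (u (σ p.2) - t * u (σ p.1)) / (t * u (σ p.2) - u (σ p.1))) *
    ∏ j, ((e * u (σ j) + f) / (a * u (σ j) + b)) ^ x j

/-- `H_x̄(u₁, …, u_L)` on `M` sites, for the parameters `a, b, c, e, f, t`. -/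
def symH (a b c e f t : ℂ) (M : ℕ) {L : ℕ} (x : Fin L → ℕ) (u : Fin L → ℂ) : ℂ :=
  (∏ j, (1 - t) * c * u j * (a * t * u j + b) ^ M / (e * u j + t * f)) *
  (∏ p ∈ ltPairs L, (u p.1 - t * u p.2) / (t * (u p.1 - u p.2))) *
  ∑ σ : Equiv.Perm (Fin L),
    (∏ p ∈ inversionPairs σ,
      (t * u (σ p.2) - u (σ p.1)) / (u (σ p.2) - t * u (σ p.1))) *
    ∏ j, ((e * u (σ j) + t * f) / (a * t * u (σ j) + b)) ^ x j

/-- The matrix of the homogeneous determinant; its `(j, k)` entry, `1 ≤ j, k ≤ M`, is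
`(a uⱼ + b)^M (-f)^k (e uⱼ + f)^(M-k) - (e uⱼ + f)^M (-b)^k (a uⱼ + b)^(M-k)`.
The index `k : Fin M` stands for `k + 1`. -/
def homogeneousMatrix (a b e f : ℂ) {M : ℕ} (u : Fin M → ℂ) : Matrix (Fin M) (Fin M) ℂ :=
  Matrix.of fun j k =>
    (a * u j + b) ^ M * (-f) ^ (k.val + 1) * (e * u j + f) ^ (M - (k.val + 1)) -
    (e * u j + f) ^ M * (-b) ^ (k.val + 1) * (a * u j + b) ^ (M - (k.val + 1))

/-- The first `M - N` of the variables `u₁, …, u_M`. -/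
def firstVars {M : ℕ} (N : ℕ) (u : Fin M → ℂ) (i : Fin (M - N)) : ℂ :=
  u (Fin.castLE (Nat.sub_le M N) i)

/-- The last `N` of the variables `u₁, …, u_M`, that is `u_{M-N+1}, …, u_M`. -/
def lastVars {M N : ℕ} (hN : N ≤ M) (u : Fin M → ℂ) (j : Fin N) : ℂ :=
  u ⟨M - N + j.val, by omega⟩

end

/-!
The sums in `G` and `H` are symmetrizations: by `prod_ltPairs_mul_prod_inversionPairs`, the factors
at the inversions of `σ` turn the product over `j < k` in the prefactor into the same product at
the permuted variables. Colour the last `N` variables as particles and the others as holes. A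
configuration together with a permutation of the variables of either colour is the same as a
placement of all variables on the sites (`placement_bijective`), so the left-hand side becomes a
single sum over the permutations of `M` letters (`sum_placementSum_mul`), in which pairs of
different colours do not interact. Summing over the variable on the first site gives a recursion in
`M` (`IsGeneric.colourSum_mul_preWeight_succ`).

On the other side, with `p = a u + b` and `q = e u + f`, each row of the determinant is a difference
of two geometric progressions, with ratios `-f / q` and `-b / p`. Expanding the determinant in its
rows gives a sum of Vandermonde determinants over the choices `s` of a type for every variable
(`IsGeneric.det_homogeneousMatrix`), and the relation `b e = t a f` makes all differences of nodes
factor.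

It remains to see that this sum over types satisfies the recursion, whatever the colours are
(`IsGeneric.typeSum_succ`). For fixed `s`, the terms of the recursion, removing one variable each,
are the partial fractions of a product `∏ (x - oᵢ) / (x - zᵢ)` at `x = -f / e`, where `i` runs over
the variables whose type agrees with their colour and `{oᵢ, zᵢ} = {uᵢ, uᵢ / t}`
(`IsGeneric.sum_firstWeight`). The product itself yields the term of `s` for one more variable. The
constant term `1` of the partial fraction expansion leaves a sum over `s` which, up to a factor, is
a determinant with a zero column (`IsGeneric.sum_typePair_eq_zero`).

This argument divides by `b`, `e`, `t` and by `t uᵢ - uⱼ` for all `i ≠ j`. The general case follows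
by continuity, along the curve that adds `ε` to `b`, to `e` and to every variable
(`eventually_isGeneric`).
-/

noncomputable section

/-! ### Products over pairs of indices -/

theorem prod_ltPairs {n : ℕ} (F : Fin n → Fin n → ℂ) :
    ∏ p ∈ ltPairs n, F p.1 p.2 = ∏ i, ∏ j, if i < j then F i j else 1 := by
  rw [ltPairs, Finset.prod_filter, ← Finset.univ_product_univ, Finset.prod_product]

theorem prod_ltPairs_succ {n : ℕ} (F : Fin (n + 1) → Fin (n + 1) → ℂ) :
    ∏ p ∈ ltPairs (n + 1), F p.1 p.2 =
      (∏ k : Fin n, F 0 k.succ) * ∏ p ∈ ltPairs n, F p.1.succ p.2.succ := by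
  rw [prod_ltPairs, prod_ltPairs (fun i j => F i.succ j.succ), Fin.prod_univ_succ]
  simp [Fin.prod_univ_succ]

/-- Removing the index `j` from a product over pairs of a symmetric function. -/
theorem prod_ltPairs_succAbove {n : ℕ} (F : Fin (n + 1) → Fin (n + 1) → ℂ)
    (hF : ∀ i j, F i j = F j i) (j : Fin (n + 1)) :
    ∏ p ∈ ltPairs (n + 1), F p.1 p.2 =
      (∏ k, F j (j.succAbove k)) * ∏ p ∈ ltPairs n, F (j.succAbove p.1) (j.succAbove p.2) := by
  rw [prod_ltPairs, prod_ltPairs (fun i k => F (j.succAbove i) (j.succAbove k)),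
    Fin.prod_univ_succAbove _ j]
  simp only [Fin.prod_univ_succAbove _ j, lt_irrefl, if_false, one_mul,
    Finset.prod_mul_distrib, ← mul_assoc, Fin.succAbove_lt_succAbove_iff]
  congr 1
  rw [← Finset.prod_mul_distrib]
  refine Finset.prod_congr rfl fun k _ => ?_
  rcases lt_or_gt_of_ne (Fin.succAbove_ne j k) with h | h
  · simp [h, h.not_gt, hF j]
  · simp [h, h.not_gt]

theorem prod_ltPairs_const (n : ℕ) (r : ℂ) :
    ∏ _p ∈ ltPairs n, r = r ^ (n * (n - 1) / 2) := by
  induction n with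
  | zero => simp [ltPairs]
  | succ n ih =>
    rw [prod_ltPairs_succ (fun _ _ => r), ih, Nat.triangle_succ]
    simp [pow_add, mul_comm]

theorem prod_ltPairs_mul {n : ℕ} (η : Fin n → ℂ) :
    ∏ p ∈ ltPairs n, (η p.1 * η p.2) = (∏ i, η i) ^ (n - 1) := by
  induction n with
  | zero => simp [ltPairs]
  | succ n ih =>
    rw [prod_ltPairs_succ (fun i j => η i * η j), ih (fun i => η i.succ), Fin.prod_univ_succ,
      Finset.prod_mul_distrib]
    rcases n with _ | n
    · simp
    · simp
      ring

/-- A product over pairs of a symmetric function is invariant under permutations. -/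
theorem prod_ltPairs_perm {n : ℕ} (F : Fin n → Fin n → ℂ) (hF : ∀ i j, F i j = F j i)
    (σ : Equiv.Perm (Fin n)) :
    ∏ p ∈ ltPairs n, F (σ p.1) (σ p.2) = ∏ p ∈ ltPairs n, F p.1 p.2 := by
  have key : ∀ (τ : Equiv.Perm (Fin n)) (p : Fin n × Fin n), p ∈ ltPairs n →
      (if τ p.1 < τ p.2 then (τ p.1, τ p.2) else (τ p.2, τ p.1)) ∈ ltPairs n := by
    intro τ p hp
    simp only [ltPairs, Finset.mem_filter, Finset.mem_univ, true_and] at hp ⊢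
    split_ifs with h
    · exact h
    · exact lt_of_le_of_ne (not_lt.1 h) (fun h' => hp.ne' (τ.injective h'))
  refine Finset.prod_nbij'
    (fun p => if σ p.1 < σ p.2 then (σ p.1, σ p.2) else (σ p.2, σ p.1))
    (fun p => if σ⁻¹ p.1 < σ⁻¹ p.2 then (σ⁻¹ p.1, σ⁻¹ p.2) else (σ⁻¹ p.2, σ⁻¹ p.1))
    (fun p hp => key σ p hp) (fun p hp => key σ⁻¹ p hp) ?_ ?_ ?_
  · intro p hp
    simp only [ltPairs, Finset.mem_filter, Finset.mem_univ, true_and] at hp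
    by_cases h : σ p.1 < σ p.2
    · simp [h, hp]
    · simp [h, hp.not_gt]
  · intro p hp
    simp only [ltPairs, Finset.mem_filter, Finset.mem_univ, true_and] at hp
    by_cases h : σ⁻¹ p.1 < σ⁻¹ p.2
    · simp only [h, if_true]
      simp [hp]
    · simp only [h, if_false]
      simp [hp.not_gt]
  · intro p _
    split_ifs
    · rfl
    · exact hF _ _

/-- Exchanging the two arguments of `F` at the inversions of `σ` turns the product of `F` over the
pairs `i < j` into the product of `F` over the permuted pairs. -/
theorem prod_ltPairs_mul_prod_inversionPairs {n : ℕ} (F : Fin n → Fin n → ℂ)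
    (hF : ∀ i j, i ≠ j → F i j ≠ 0) (σ : Equiv.Perm (Fin n)) :
    (∏ p ∈ ltPairs n, F p.1 p.2) *
        ∏ p ∈ inversionPairs σ, F (σ p.1) (σ p.2) / F (σ p.2) (σ p.1) =
      ∏ p ∈ ltPairs n, F (σ p.1) (σ p.2) := by
  -- The product of `F` over the ordered pairs is that of the symmetric function
  -- `(i, j) ↦ F (min i j) (max i j)`, hence invariant under `σ`.
  have h1 : ∏ p ∈ ltPairs n, F p.1 p.2 =
      ∏ p ∈ ltPairs n, (if p.1 < p.2 then F p.1 p.2 else F p.2 p.1) := by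
    refine Finset.prod_congr rfl fun p hp => ?_
    simp only [ltPairs, Finset.mem_filter, Finset.mem_univ, true_and] at hp
    simp [hp]
  have h2 : inversionPairs σ = (ltPairs n).filter fun p => σ p.2 < σ p.1 := by
    ext p
    simp [inversionPairs, ltPairs]
  rw [h1, ← prod_ltPairs_perm (fun i j => if i < j then F i j else F j i) ?_ σ, h2,
    Finset.prod_filter, ← Finset.prod_mul_distrib]
  · refine Finset.prod_congr rfl fun p hp => ?_
    simp only [ltPairs, Finset.mem_filter, Finset.mem_univ, true_and] at hp
    have hne : σ p.1 ≠ σ p.2 := fun h => hp.ne (σ.injective h)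
    rcases lt_or_gt_of_ne hne with h | h
    · simp [h, h.not_gt]
    · simp [h, h.not_gt, mul_div_cancel₀ _ (hF _ _ hne.symm)]
  · intro i j
    rcases lt_trichotomy i j with h | h | h
    · simp [h, h.not_gt]
    · simp [h]
    · simp [h, h.not_gt]

/-! ### Sums over permutations and over two-colourings -/

/-- Summing over the permutations of `Fin (n + 1)` by the value at `0`. -/
theorem sum_perm_succ {n : ℕ} (F : (Fin (n + 1) → Fin (n + 1)) → ℂ) :
    ∑ π : Equiv.Perm (Fin (n + 1)), F π =
      ∑ j : Fin (n + 1), ∑ τ : Equiv.Perm (Fin n),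
        F (Fin.cons j fun m => j.succAbove (τ m)) := by
  let Φ : Fin (n + 1) × Equiv.Perm (Fin n) → Equiv.Perm (Fin (n + 1)) := fun q =>
    (finSuccEquiv n).trans ((Equiv.optionCongr q.2).trans (finSuccEquiv' q.1).symm)
  have hΦ : ∀ q, (Φ q : Fin (n + 1) → Fin (n + 1)) =
      Fin.cons q.1 fun m => q.1.succAbove (q.2 m) := by
    intro q
    funext i
    refine Fin.cases ?_ (fun m => ?_) i <;> simp [Φ]
  have hinj : Function.Injective Φ := by
    rintro ⟨j, τ⟩ ⟨j', τ'⟩ h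
    have h' := congrArg (fun π : Equiv.Perm (Fin (n + 1)) => (π : Fin (n + 1) → Fin (n + 1))) h
    simp only [hΦ, Fin.cons_inj] at h'
    obtain ⟨rfl, h2⟩ := h'
    have : τ = τ' := Equiv.ext fun m => Fin.succAbove_right_injective (congrFun h2 m)
    rw [this]
  have hbij : Function.Bijective Φ := by
    rw [Fintype.bijective_iff_injective_and_card]
    refine ⟨hinj, ?_⟩
    simp [Fintype.card_perm, Nat.factorial_succ]
  rw [← hbij.sum_comp, Fintype.sum_prod_type]
  simp [hΦ]

theorem sum_ite_eq_sum_insertNth {n : ℕ} (j : Fin (n + 1)) (c : Bool)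
    (F : (Fin (n + 1) → Bool) → ℂ) :
    ∑ s, (if s j = c then F s else 0) =
      ∑ s : Fin n → Bool, F (j.insertNth c s : Fin (n + 1) → Bool) := by
  rw [← (Fin.insertNthEquiv (fun _ => Bool) j).sum_comp, Fintype.sum_prod_type]
  simp [Fin.insertNthEquiv]

/-! ### Partial fractions -/

/-- The partial fraction expansion of `∏ (x - o i) / (x - z i)`. -/
theorem prod_div_eq_one_add_sum {ι : Type*} [DecidableEq ι] (J : Finset ι) (z o : ι → ℂ) (x : ℂ)
    (hz : ∀ i ∈ J, ∀ j ∈ J, z i = z j → i = j) (hx : ∀ i ∈ J, x - z i ≠ 0) :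
    ∏ i ∈ J, (x - o i) / (x - z i) =
      1 + ∑ j ∈ J, (z j - o j) / (x - z j) * ∏ k ∈ J.erase j, (z j - o k) / (z j - z k) := by
  -- The difference of the two monic products has degree less than `#J`, so it is its own Lagrange
  -- interpolation polynomial at the nodes `z i`.
  set P : Polynomial ℂ := ∏ i ∈ J, (Polynomial.X - Polynomial.C (o i)) -
    ∏ i ∈ J, (Polynomial.X - Polynomial.C (z i)) with hP
  have hinj : Set.InjOn z J := fun i hi j hj h => hz i hi j hj h
  have hdeg : P.degree < J.card := by
    have m1 := Polynomial.monic_prod_of_monic J (fun i => Polynomial.X - Polynomial.C (o i))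
      fun i _ => Polynomial.monic_X_sub_C _
    have m2 := Polynomial.monic_prod_of_monic J (fun i => Polynomial.X - Polynomial.C (z i))
      fun i _ => Polynomial.monic_X_sub_C _
    have d1 : (∏ i ∈ J, (Polynomial.X - Polynomial.C (o i))).degree = (J.card : WithBot ℕ) := by
      simp [Polynomial.degree_prod]
    have d2 : (∏ i ∈ J, (Polynomial.X - Polynomial.C (z i))).degree = (J.card : WithBot ℕ) := by
      simp [Polynomial.degree_prod]
    rw [← d1]
    exact Polynomial.degree_sub_lt_left (by rw [d1, d2]) m1.ne_zero
      (by rw [m1.leadingCoeff, m2.leadingCoeff])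
  have hint := Lagrange.eq_interpolate hinj hdeg
  have hev := congrArg (Polynomial.eval x) hint
  rw [Lagrange.interpolate_apply, Polynomial.eval_finsetSum] at hev
  have hprod : ∏ i ∈ J, (x - z i) ≠ 0 := Finset.prod_ne_zero_iff.2 hx
  rw [Finset.prod_div_distrib, div_eq_iff hprod, add_mul, one_mul, ← sub_eq_iff_eq_add']
  have hL : Polynomial.eval x P = ∏ i ∈ J, (x - o i) - ∏ i ∈ J, (x - z i) := by
    simp [hP, Polynomial.eval_prod]
  rw [← hL, hev, Finset.sum_mul]
  refine Finset.sum_congr rfl fun j hj => ?_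
  have hPj : Polynomial.eval (z j) P = (z j - o j) * ∏ k ∈ J.erase j, (z j - o k) := by
    rw [Finset.mul_prod_erase J (fun k => z j - o k) hj]
    simp only [hP, Polynomial.eval_sub, Polynomial.eval_prod, Polynomial.eval_X, Polynomial.eval_C]
    rw [Finset.prod_eq_zero hj (f := fun k => z j - z k) (sub_self _), sub_zero]
  rw [Polynomial.eval_mul, Polynomial.eval_C, hPj, Lagrange.basis, Polynomial.eval_prod,
    ← Finset.mul_prod_erase J (fun k => x - z k) hj]
  simp only [Lagrange.basisDivisor, Polynomial.eval_mul, Polynomial.eval_C, Polynomial.eval_sub,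
    Polynomial.eval_X]
  have := hx j hj
  simp only [Finset.prod_mul_distrib, div_eq_mul_inv]
  field_simp

/-! ### The coloured permutation sum -/

/-- The weight of an ordered pair of variables with given colours, where `true` marks a variable
of `G` (a particle) and `false` a variable of `H` (a hole). Variables of different colours do not
interact. -/
def pairWeight (t : ℂ) : Bool → Bool → ℂ → ℂ → ℂ
  | true, true, x, y => (t * x - y) / (x - y)
  | false, false, x, y => (x - t * y) / (t * (x - y))
  | _, _, _, _ => 1

/-- The weight by which a variable of the given colour picks up a power at its site. -/
def siteWeight (a b e f t : ℂ) : Bool → ℂ → ℂ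
  | true, x => (e * x + f) / (a * x + b)
  | false, x => (e * x + t * f) / (a * t * x + b)

/-- The prefactor, up to `c`, that a variable of the given colour contributes to `G` or `H` on
`n` sites. -/
def preWeight (a b e f t : ℂ) (n : ℕ) : Bool → ℂ → ℂ
  | true, x => (1 - t) * x * (a * x + b) ^ n / (e * x + f)
  | false, x => (1 - t) * x * (a * t * x + b) ^ n / (e * x + t * f)

/-- The sum, over all placements `π` of the coloured variables on the sites, of the pair weights
taken in the order of the sites and the powers of the site weights. -/
def colourSum (a b e f t : ℂ) {n : ℕ} (col : Fin n → Bool) (u : Fin n → ℂ) : ℂ :=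
  ∑ π : Equiv.Perm (Fin n),
    (∏ p ∈ ltPairs n, pairWeight t (col (π p.1)) (col (π p.2)) (u (π p.1)) (u (π p.2))) *
      ∏ m, siteWeight a b e f t (col (π m)) (u (π m)) ^ (m.val + 1)

/-- The factor a variable acquires when a site occupied by another variable is removed. -/
def keepWeight (e f t : ℂ) : Bool → ℂ → ℂ
  | true, x => e * x + f
  | false, x => e * x + t * f

/-- The factor of the variable that occupies the first of `n + 1` sites. -/
def firstWeight (a b t : ℂ) (n : ℕ) : Bool → ℂ → ℂ
  | true, x => (1 - t) * x * (a * x + b) ^ n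
  | false, x => (1 - t) * x * (a * t * x + b) ^ n

theorem colourSum_succ (a b e f t : ℂ) {n : ℕ} (col : Fin (n + 1) → Bool) (u : Fin (n + 1) → ℂ) :
    colourSum a b e f t col u =
      (∏ i, siteWeight a b e f t (col i) (u i)) *
        ∑ j, (∏ k, pairWeight t (col j) (col (j.succAbove k)) (u j) (u (j.succAbove k))) *
          colourSum a b e f t (col ∘ j.succAbove) (u ∘ j.succAbove) := by
  have h := sum_perm_succ (n := n) fun π =>
    (∏ p ∈ ltPairs (n + 1), pairWeight t (col (π p.1)) (col (π p.2)) (u (π p.1)) (u (π p.2))) *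
      ∏ m, siteWeight a b e f t (col (π m)) (u (π m)) ^ (m.val + 1)
  rw [colourSum, h, Finset.mul_sum]
  refine Finset.sum_congr rfl fun j _ => ?_
  rw [colourSum, Finset.mul_sum, Finset.mul_sum]
  refine Finset.sum_congr rfl fun τ _ => ?_
  set π : Fin (n + 1) → Fin (n + 1) := Fin.cons j fun m => j.succAbove (τ m) with hπ
  rw [prod_ltPairs_succ (fun i k => pairWeight t (col (π i)) (col (π k)) (u (π i)) (u (π k))),
    Fin.prod_univ_succ, Fin.prod_univ_succAbove (fun i => siteWeight a b e f t (col i) (u i)) j]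
  rw [hπ]
  simp only [Fin.cons_zero, Fin.cons_succ, Fin.val_zero, Fin.val_succ, Function.comp, zero_add,
    pow_one]
  rw [Equiv.prod_comp τ
      (fun k => pairWeight t (col j) (col (j.succAbove k)) (u j) (u (j.succAbove k))),
    ← Equiv.prod_comp τ (fun k => siteWeight a b e f t (col (j.succAbove k)) (u (j.succAbove k)))]
  simp only [pow_succ _ (_ + 1), Finset.prod_mul_distrib]
  ring

/-- The genericity assumptions under which the pairing formula is proved by recursion; the general
case follows by continuity. Together with `hb` and `he`, the constraint `rel` implies that `t`, `a`
and `f` do not vanish; therefore the conditions listed also exclude zero denominators in `H`. -/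
structure IsGeneric (a b e f t : ℂ) {n : ℕ} (u : Fin n → ℂ) : Prop where
  rel : b * e = t * a * f
  hb : b ≠ 0
  he : e ≠ 0
  inj : Function.Injective u
  num : ∀ i, a * u i + b ≠ 0
  den : ∀ i, e * u i + f ≠ 0
  mul_sub : ∀ i j, i ≠ j → t * u i - u j ≠ 0

namespace IsGeneric

variable {a b e f t : ℂ} {n : ℕ} {u : Fin n → ℂ}

theorem taf_ne_zero (h : IsGeneric a b e f t u) : t * a * f ≠ 0 :=
  h.rel ▸ mul_ne_zero h.hb h.he

theorem ht (h : IsGeneric a b e f t u) : t ≠ 0 := left_ne_zero_of_mul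
  (left_ne_zero_of_mul h.taf_ne_zero)

theorem ha (h : IsGeneric a b e f t u) : a ≠ 0 := right_ne_zero_of_mul
  (left_ne_zero_of_mul h.taf_ne_zero)

theorem hf (h : IsGeneric a b e f t u) : f ≠ 0 := right_ne_zero_of_mul h.taf_ne_zero

theorem comp (h : IsGeneric a b e f t u) {m : ℕ} {φ : Fin m → Fin n}
    (hφ : Function.Injective φ) : IsGeneric a b e f t (u ∘ φ) where
  rel := h.rel
  hb := h.hb
  he := h.he
  inj := h.inj.comp hφ
  num _ := h.num _
  den _ := h.den _
  mul_sub _ _ hij := h.mul_sub _ _ (hφ.ne hij)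

theorem sub_ne_zero (h : IsGeneric a b e f t u) {i j : Fin n} (hij : i ≠ j) : u i - u j ≠ 0 :=
  _root_.sub_ne_zero.2 (h.inj.ne hij)

theorem e_mul_add (h : IsGeneric a b e f t u) (x : ℂ) :
    e * x + t * f = t * f / b * (a * x + b) := by
  have := h.hb
  field_simp
  linear_combination x * h.rel

theorem at_mul_add (h : IsGeneric a b e f t u) (x : ℂ) :
    a * t * x + b = b / f * (e * x + f) := by
  have := h.hf
  field_simp
  linear_combination - x * h.rel

theorem keepWeight_ne_zero (h : IsGeneric a b e f t u) (c : Bool) (i : Fin n) :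
    keepWeight e f t c (u i) ≠ 0 := by
  cases c
  · rw [keepWeight, h.e_mul_add]
    exact mul_ne_zero (div_ne_zero (mul_ne_zero h.ht h.hf) h.hb) (h.num i)
  · exact h.den i

theorem at_mul_add_ne_zero (h : IsGeneric a b e f t u) (i : Fin n) :
    a * t * u i + b ≠ 0 := by
  rw [h.at_mul_add]
  exact mul_ne_zero (div_ne_zero h.hb h.hf) (h.den i)

theorem siteWeight_mul_preWeight (h : IsGeneric a b e f t u) (N : ℕ) (c : Bool) (i : Fin n) :
    siteWeight a b e f t c (u i) * preWeight a b e f t (N + 1) c (u i) =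
      keepWeight e f t c (u i) * preWeight a b e f t N c (u i) := by
  have h1 := h.keepWeight_ne_zero c i
  have h2 := h.at_mul_add_ne_zero i
  have h3 := h.num i
  cases c <;> simp only [siteWeight, preWeight, keepWeight] at h1 ⊢ <;>
    generalize a * t * u i + b = P at * <;> generalize a * u i + b = Q at * <;> field_simp <;> ring

theorem siteWeight_mul_preWeight_eq_firstWeight (h : IsGeneric a b e f t u) (N : ℕ) (c : Bool)
    (i : Fin n) :
    siteWeight a b e f t c (u i) * preWeight a b e f t (N + 1) c (u i) =
      firstWeight a b t N c (u i) := by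
  have h1 := h.keepWeight_ne_zero c i
  have h2 := h.at_mul_add_ne_zero i
  have h3 := h.num i
  cases c <;> simp only [siteWeight, preWeight, keepWeight, firstWeight] at h1 ⊢ <;>
    generalize a * t * u i + b = P at * <;> generalize a * u i + b = Q at * <;> field_simp <;> ring

end IsGeneric

/-- The recursion over the variable that occupies the first site. -/
theorem IsGeneric.colourSum_mul_preWeight_succ {a b e f t : ℂ} {n : ℕ} {u : Fin (n + 1) → ℂ}
    (h : IsGeneric a b e f t u) (col : Fin (n + 1) → Bool) :
    colourSum a b e f t col u * ∏ i, preWeight a b e f t (n + 1) (col i) (u i) =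
      ∑ j, firstWeight a b t n (col j) (u j) *
        (∏ k, pairWeight t (col j) (col (j.succAbove k)) (u j) (u (j.succAbove k)) *
          keepWeight e f t (col (j.succAbove k)) (u (j.succAbove k))) *
        (colourSum a b e f t (col ∘ j.succAbove) (u ∘ j.succAbove) *
          ∏ k, preWeight a b e f t n (col (j.succAbove k)) (u (j.succAbove k))) := by
  rw [colourSum_succ, mul_right_comm, ← Finset.prod_mul_distrib, Finset.mul_sum]
  refine Finset.sum_congr rfl fun j _ => ?_
  rw [Fin.prod_univ_succAbove _ j, h.siteWeight_mul_preWeight_eq_firstWeight,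
    Finset.prod_congr rfl fun k _ => h.siteWeight_mul_preWeight n (col (j.succAbove k)) _]
  simp only [Finset.prod_mul_distrib]
  ring

/-! ### The determinant as a sum over two-colourings -/

/-- Expanding each row of `det (α₁ x₁ᵏ + α₀ x₀ᵏ)` gives a sum of Vandermonde determinants. -/
theorem det_sum_mul_pow {m : ℕ} (α ζ : Bool → Fin m → ℂ) :
    (Matrix.of fun i k : Fin m => α true i * ζ true i ^ k.val + α false i * ζ false i ^ k.val).det =
      ∑ s : Fin m → Bool, (∏ i, α (s i) i) *
        ∏ p ∈ ltPairs m, (ζ (s p.2) p.2 - ζ (s p.1) p.1) := by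
  have h := (Matrix.detRowAlternating (n := Fin m) (R := ℂ)).toMultilinearMap.map_sum
    (fun i (β : Bool) => fun k : Fin m => α β i * ζ β i ^ k.val)
  have e1 : (Matrix.of fun i k : Fin m =>
      α true i * ζ true i ^ k.val + α false i * ζ false i ^ k.val) =
      fun i => ∑ β : Bool, fun k : Fin m => α β i * ζ β i ^ k.val := by
    funext i k
    simp
  rw [e1]
  refine h.trans (Finset.sum_congr rfl fun s _ => ?_)
  refine (Matrix.det_mul_column (fun i => α (s i) i)
    (Matrix.vandermonde fun i => ζ (s i) i)).trans ?_
  rw [Matrix.det_vandermonde, prod_ltPairs (fun i j => ζ (s j) j - ζ (s i) i)]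
  congr 1
  refine Finset.prod_congr rfl fun i _ => ?_
  rw [← Finset.prod_filter]
  congr 1
  ext j
  simp

/-- The weight of a variable in the expansion of the determinant, where `true` means that the
first summand of its row is chosen and `false` the second. -/
def typeWeight (a b e f : ℂ) (n : ℕ) : Bool → ℂ → ℂ
  | true, x => -f * (a * x + b) ^ n
  | false, x => b * (e * x + f) ^ n

/-- The weight of a pair of variables in the expansion of the determinant. -/
def typePair (b f t : ℂ) : Bool → Bool → ℂ → ℂ → ℂ
  | true, true, _, _ => t * f / b
  | false, false, _, _ => b / f
  | true, false, x, y => (t * x - y) / (x - y)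
  | false, true, x, y => (t * y - x) / (y - x)

theorem typePair_comm (b f t : ℂ) (s s' : Bool) (x y : ℂ) :
    typePair b f t s s' x y = typePair b f t s' s y x := by
  cases s <;> cases s' <;> rfl

/-- The node of the Vandermonde determinant attached to a variable. -/
def node (a b e f : ℂ) : Bool → ℂ → ℂ
  | true, x => -f / (e * x + f)
  | false, x => -b / (a * x + b)

/-- The reciprocal of the denominator of `node`. -/
def nodeInv (a b e f : ℂ) : Bool → ℂ → ℂ
  | true, x => 1 / (e * x + f)
  | false, x => 1 / (a * x + b)

namespace IsGeneric

variable {a b e f t : ℂ} {n : ℕ} {u : Fin n → ℂ}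

theorem node_sub_node (h : IsGeneric a b e f t u) (s s' : Bool) {i j : Fin n} (hij : i ≠ j) :
    node a b e f s' (u j) - node a b e f s (u i) =
      -(a * f) * (u i - u j) * (nodeInv a b e f s (u i) * nodeInv a b e f s' (u j)) *
        typePair b f t s s' (u i) (u j) := by
  have h1 := h.sub_ne_zero hij
  have h1' := h.sub_ne_zero hij.symm
  have h2 := h.num i
  have h3 := h.num j
  have h4 := h.den i
  have h5 := h.den j
  have hb := h.hb
  have hf := h.hf
  have hr := h.rel
  cases s <;> cases s' <;> simp only [node, nodeInv, typePair] <;> field_simp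
  · ring
  · linear_combination (u j - u i) * u j * hr
  · linear_combination -u i * hr
  · linear_combination (u j - u i) * hr

theorem det_node (h : IsGeneric a b e f t u) (α : Bool → Fin n → ℂ) :
    (Matrix.of fun i k : Fin n => α true i * node a b e f true (u i) ^ k.val +
        α false i * node a b e f false (u i) ^ k.val).det =
      (-(a * f)) ^ (n * (n - 1) / 2) * (∏ p ∈ ltPairs n, (u p.1 - u p.2)) *
        ∑ s : Fin n → Bool, (∏ i, α (s i) i * nodeInv a b e f (s i) (u i) ^ (n - 1)) *
          ∏ p ∈ ltPairs n, typePair b f t (s p.1) (s p.2) (u p.1) (u p.2) := by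
  rw [det_sum_mul_pow α (fun s i => node a b e f s (u i)), Finset.mul_sum]
  refine Finset.sum_congr rfl fun s _ => ?_
  have : ∏ p ∈ ltPairs n, (node a b e f (s p.2) (u p.2) - node a b e f (s p.1) (u p.1)) =
      ∏ p ∈ ltPairs n, (-(a * f) * (u p.1 - u p.2) *
        (nodeInv a b e f (s p.1) (u p.1) * nodeInv a b e f (s p.2) (u p.2)) *
        typePair b f t (s p.1) (s p.2) (u p.1) (u p.2)) := by
    refine Finset.prod_congr rfl fun p hp => h.node_sub_node _ _ ?_
    simp only [ltPairs, Finset.mem_filter, Finset.mem_univ, true_and] at hp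
    exact hp.ne
  rw [this]
  simp only [Finset.prod_mul_distrib]
  rw [prod_ltPairs_const, ← Finset.prod_mul_distrib,
    prod_ltPairs_mul (fun i => nodeInv a b e f (s i) (u i)), Finset.prod_pow]
  ring

end IsGeneric

/-- The expansion of the homogeneous determinant over the choice of a summand in each row, divided
by its trivial factors. -/
def typeSum (a b e f t : ℂ) {n : ℕ} (u : Fin n → ℂ) : ℂ :=
  ∑ s : Fin n → Bool, (∏ i, typeWeight a b e f n (s i) (u i)) *
    ∏ p ∈ ltPairs n, typePair b f t (s p.1) (s p.2) (u p.1) (u p.2)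

theorem IsGeneric.det_homogeneousMatrix {a b e f t : ℂ} {n : ℕ} {u : Fin n → ℂ}
    (h : IsGeneric a b e f t u) :
    (homogeneousMatrix a b e f u).det =
      (-(a * f)) ^ (n * (n - 1) / 2) * (∏ p ∈ ltPairs n, (u p.1 - u p.2)) *
        typeSum a b e f t u := by
  let α : Bool → Fin n → ℂ := fun s i => if s then -f * (a * u i + b) ^ n * (e * u i + f) ^ (n - 1)
    else b * (e * u i + f) ^ n * (a * u i + b) ^ (n - 1)
  have e1 : homogeneousMatrix a b e f u = Matrix.of fun i k : Fin n =>
      α true i * node a b e f true (u i) ^ k.val +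
        α false i * node a b e f false (u i) ^ k.val := by
    ext i k
    have h1 := h.num i
    have h2 := h.den i
    have h3 : n - 1 = k.val + (n - (k.val + 1)) := by omega
    simp only [homogeneousMatrix, Matrix.of_apply, α, node, h3, pow_add, div_pow]
    simp only [if_true, Bool.false_eq_true, if_false]
    generalize a * u i + b = P at *
    generalize e * u i + f = Q at *
    field_simp
    ring
  rw [e1, h.det_node, typeSum]
  congr 1
  refine Finset.sum_congr rfl fun s _ => ?_
  congr 1
  refine Finset.prod_congr rfl fun i _ => ?_
  have h1 := h.num i
  have h2 := h.den i
  cases s i <;> simp only [α, nodeInv, typeWeight, div_pow, one_pow, if_true,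
      Bool.false_eq_true, if_false] <;>
    generalize a * u i + b = P at * <;> generalize e * u i + f = Q at * <;> field_simp

/-- The analogue of `typeSum` with one site fewer than variables vanishes: it is the determinant of
a matrix whose column of exponent `0` is zero. -/
theorem IsGeneric.sum_typePair_eq_zero {a b e f t : ℂ} {n : ℕ} {u : Fin (n + 1) → ℂ}
    (h : IsGeneric a b e f t u) :
    ∑ s : Fin (n + 1) → Bool,
      (∏ i, if s i then (a * u i + b) ^ n else -(e * u i + f) ^ n) *
        ∏ p ∈ ltPairs (n + 1), typePair b f t (s p.1) (s p.2) (u p.1) (u p.2) = 0 := by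
  let α : Bool → Fin (n + 1) → ℂ := fun s i =>
    (if s then 1 else -1) * ((a * u i + b) ^ n * (e * u i + f) ^ n)
  have hdet := h.det_node α
  rw [Matrix.det_eq_zero_of_column_eq_zero 0 (by intro i; simp [α])] at hdet
  have hΔ : ∏ p ∈ ltPairs (n + 1), (u p.1 - u p.2) ≠ 0 := by
    refine Finset.prod_ne_zero_iff.2 fun p hp => h.sub_ne_zero ?_
    simp only [ltPairs, Finset.mem_filter, Finset.mem_univ, true_and] at hp
    exact hp.ne
  have haf : (-(a * f)) ^ ((n + 1) * (n + 1 - 1) / 2) ≠ 0 :=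
    pow_ne_zero _ (neg_ne_zero.2 (mul_ne_zero h.ha h.hf))
  have h0 := (mul_eq_zero.1 hdet.symm).resolve_left (mul_ne_zero haf hΔ)
  rw [← h0]
  refine Finset.sum_congr rfl fun s _ => ?_
  congr 1
  refine Finset.prod_congr rfl fun i _ => ?_
  have h1 := h.num i
  have h2 := h.den i
  cases s i <;> simp only [α, nodeInv, if_true, Bool.false_eq_true, if_false] <;>
    generalize a * u i + b = P at * <;> generalize e * u i + f = Q at * <;> simp <;> field_simp

/-! ### The recursion for the expanded determinant -/

/-- The pole attached to a variable in the partial fraction expansion. -/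
def poleAt (t : ℂ) : Bool → ℂ → ℂ
  | true, x => x
  | false, x => x / t

/-- The zero attached to a variable in the partial fraction expansion. -/
def zeroAt (t : ℂ) : Bool → ℂ → ℂ
  | true, x => x / t
  | false, x => x

/-- The part of a pair factor of the recursion that depends on one of the variables only: the first
argument is the colour, the second the type of that variable. -/
def scaleWeight (b e f t : ℂ) (c s : Bool) (x : ℂ) : ℂ :=
  (if s then b / f else 1) * (if c then e * x + f else (e * x + t * f) / t)

/-- The factor left of a variable when a variable whose pole is `z` is removed. It is trivial unless
the type of the variable agrees with its colour. -/
def ratioAt (t : ℂ) (c s : Bool) (z x : ℂ) : ℂ :=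
  if s = c then (z - zeroAt t c x) / (z - poleAt t c x) else 1

namespace IsGeneric

variable {a b e f t : ℂ} {n : ℕ} {u : Fin n → ℂ}

theorem typePair_ne_zero (h : IsGeneric a b e f t u) (s s' : Bool) {i j : Fin n} (hij : i ≠ j) :
    typePair b f t s s' (u i) (u j) ≠ 0 := by
  have h1 := h.sub_ne_zero hij
  have h1' := h.sub_ne_zero hij.symm
  have h2 := h.mul_sub i j hij
  have h2' := h.mul_sub j i hij.symm
  have hb := h.hb
  have hf := h.hf
  have ht := h.ht
  cases s <;> cases s' <;> simp only [typePair] <;> positivity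

theorem typeWeight_ne_zero (h : IsGeneric a b e f t u) (N : ℕ) (s : Bool) (i : Fin n) :
    typeWeight a b e f N s (u i) ≠ 0 := by
  have h1 := h.num i
  have h2 := h.den i
  have hb := h.hb
  have hf := h.hf
  cases s <;> simp only [typeWeight]
  · positivity
  · exact mul_ne_zero (neg_ne_zero.2 hf) (pow_ne_zero _ h1)

/-- The poles of distinct variables are distinct. -/
theorem poleAt_ne (h : IsGeneric a b e f t u) (c c' : Bool) {i j : Fin n} (hij : i ≠ j) :
    poleAt t c (u i) - poleAt t c' (u j) ≠ 0 := by
  have h1 := h.sub_ne_zero hij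
  have h2 := h.mul_sub i j hij
  have h3 := h.mul_sub j i hij.symm
  have ht := h.ht
  cases c <;> cases c' <;> simp only [poleAt]
  · rw [← sub_div]
    exact div_ne_zero h1 ht
  · intro h0
    apply h3
    field_simp at h0
    linear_combination -h0
  · intro h0
    apply h2
    field_simp at h0
    linear_combination h0
  · exact h1

/-- The point `-f / e` at which the partial fractions are evaluated is not a pole. -/
theorem point_sub_poleAt (h : IsGeneric a b e f t u) (c : Bool) (i : Fin n) :
    -f / e - poleAt t c (u i) ≠ 0 := by
  have h1 := h.keepWeight_ne_zero c i
  have ht := h.ht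
  have he := h.he
  intro h0
  apply h1
  cases c <;> simp only [poleAt, keepWeight] at h0 ⊢ <;> field_simp at h0 <;>
    linear_combination -h0

/-- Removing a variable changes the term of a choice of types by these factors. Here `c` is both the
colour and the type of the variable removed. -/
theorem pairWeight_mul_keepWeight_div (h : IsGeneric a b e f t u) (c c' s' : Bool) {i j : Fin n}
    (hij : i ≠ j) :
    pairWeight t c c' (u i) (u j) * keepWeight e f t c' (u j) / typePair b f t c s' (u i) (u j) =
      (if c then 1 else f / b) * (scaleWeight b e f t c' s' (u j) *
        ratioAt t c' s' (poleAt t c (u i)) (u j)) := by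
  have h1 := h.sub_ne_zero hij
  have h1' := h.sub_ne_zero hij.symm
  have h2 := h.mul_sub i j hij
  have h3 := h.mul_sub j i hij.symm
  have h4 : u i - t * u j ≠ 0 := fun h0 => h3 (by linear_combination -h0)
  have hb := h.hb
  have hf := h.hf
  have ht := h.ht
  have e1 : u i / t - u j = (u i - t * u j) / t := by field_simp
  have e2 : u i / t - u j / t = (u i - u j) / t := by field_simp
  have e3 : u i - u j / t = (t * u i - u j) / t := by field_simp
  have e4 : t * u j - u i = -(u i - t * u j) := by ring
  have e5 : u j - u i = -(u i - u j) := by ring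
  cases c <;> cases c' <;> cases s' <;>
    simp only [pairWeight, keepWeight, typePair, scaleWeight, ratioAt, poleAt, zeroAt, if_true,
      Bool.false_eq_true, Bool.true_eq_false, if_false, e1, e2, e3, e4, e5, neg_div_neg_eq] <;>
    field_simp

/-- The factor of the variable removed, together with the powers of `f / b` collected from the other
variables by `pairWeight_mul_keepWeight_div`. -/
theorem firstWeight_div_typeWeight (h : IsGeneric a b e f t u) (c : Bool) (i : Fin n) (N : ℕ) :
    -(a * f) * (firstWeight a b t N c (u i) / typeWeight a b e f N c (u i)) *
        (if c then 1 else f / b) ^ N =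
      scaleWeight b e f t c c (u i) *
        ((poleAt t c (u i) - zeroAt t c (u i)) / (-f / e - poleAt t c (u i))) := by
  have h1 := h.num i
  have h2 := h.den i
  have hb := h.hb
  have hf := h.hf
  have ht := h.ht
  have he := h.he
  have e1 : -f / e - u i = -(e * u i + f) / e := by field_simp; ring
  have e2 : -f / e - u i / t = -(t * f / b * (a * u i + b)) / (e * t) := by
    rw [← h.e_mul_add]
    field_simp
    ring
  cases c <;>
    simp only [firstWeight, typeWeight, poleAt, zeroAt, scaleWeight, if_true, Bool.false_eq_true,
      if_false, e1, e2, h.e_mul_add, h.at_mul_add, mul_pow, div_pow, one_pow]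
  all_goals
    generalize a * u i + b = P at *
    generalize e * u i + f = Q at *
    field_simp
  · linear_combination (1 - t) * u i * h.rel
  · linear_combination (t - 1) * u i * h.rel

/-- At the point `-f / e`, the factors of the partial fractions raise the exponent in `typeWeight`. -/
theorem typeWeight_mul_scaleWeight (h : IsGeneric a b e f t u) (c s : Bool) (i : Fin n) (N : ℕ) :
    typeWeight a b e f N s (u i) *
      (scaleWeight b e f t c s (u i) * ratioAt t c s (-f / e) (u i)) =
      typeWeight a b e f (N + 1) s (u i) := by
  have h1 := h.num i
  have h2 := h.den i
  have hb := h.hb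
  have hf := h.hf
  have ht := h.ht
  have he := h.he
  have e1 : -f / e - u i = -(e * u i + f) / e := by field_simp; ring
  have e2 : -f / e - u i / t = -(t * f / b * (a * u i + b)) / (e * t) := by
    rw [← h.e_mul_add]
    field_simp
    ring
  cases c <;> cases s <;>
    simp only [typeWeight, ratioAt, poleAt, zeroAt, scaleWeight, if_true, Bool.false_eq_true,
      Bool.true_eq_false, if_false, e1, e2, h.e_mul_add]
  all_goals
    generalize a * u i + b = P at *
    generalize e * u i + f = Q at *
    field_simp
    ring

/-- The part of the recursion belonging to one choice `s` of types. Only the variables whose type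
agrees with their colour can be removed; their contributions are the partial fractions of a rational
function, evaluated at `-f / e`. -/
theorem sum_firstWeight {u : Fin (n + 1) → ℂ} (h : IsGeneric a b e f t u)
    (col s : Fin (n + 1) → Bool) :
    ∑ j, (if s j = col j then
      -(a * f) * (firstWeight a b t n (col j) (u j) / typeWeight a b e f n (col j) (u j)) *
        ∏ k, (pairWeight t (col j) (col (j.succAbove k)) (u j) (u (j.succAbove k)) *
          keepWeight e f t (col (j.succAbove k)) (u (j.succAbove k)) /
          typePair b f t (col j) (s (j.succAbove k)) (u j) (u (j.succAbove k))) else 0) =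
      (∏ i, scaleWeight b e f t (col i) (s i) (u i)) *
        (∏ i, ratioAt t (col i) (s i) (-f / e) (u i)) -
      ∏ i, scaleWeight b e f t (col i) (s i) (u i) := by
  set J : Finset (Fin (n + 1)) := Finset.univ.filter fun i => s i = col i with hJ
  have hpf := prod_div_eq_one_add_sum J (fun i => poleAt t (col i) (u i))
    (fun i => zeroAt t (col i) (u i)) (-f / e)
    (fun i _ j _ hij => by
      by_contra hne
      exact h.poleAt_ne _ _ hne (sub_eq_zero.2 hij))
    (fun i _ => h.point_sub_poleAt _ i)
  have h1 : ∏ i, ratioAt t (col i) (s i) (-f / e) (u i) =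
      ∏ i ∈ J, (-f / e - zeroAt t (col i) (u i)) / (-f / e - poleAt t (col i) (u i)) := by
    rw [hJ, Finset.prod_filter]
    rfl
  rw [h1, hpf, mul_add, mul_one, add_sub_cancel_left, Finset.mul_sum, hJ, Finset.sum_filter]
  refine Finset.sum_congr rfl fun j _ => ?_
  split_ifs with hj
  · have h2 : ∏ k, (pairWeight t (col j) (col (j.succAbove k)) (u j) (u (j.succAbove k)) *
          keepWeight e f t (col (j.succAbove k)) (u (j.succAbove k)) /
          typePair b f t (col j) (s (j.succAbove k)) (u j) (u (j.succAbove k))) =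
        (if col j then 1 else f / b) ^ n *
          ((∏ k, scaleWeight b e f t (col (j.succAbove k)) (s (j.succAbove k))
            (u (j.succAbove k))) *
          ∏ k, ratioAt t (col (j.succAbove k)) (s (j.succAbove k)) (poleAt t (col j) (u j))
            (u (j.succAbove k))) := by
      rw [Finset.prod_congr rfl fun k _ => h.pairWeight_mul_keepWeight_div (col j) _ _
        (Fin.succAbove_ne j k).symm]
      rw [Finset.prod_mul_distrib, Finset.prod_mul_distrib, Finset.prod_const, Finset.card_univ,
        Fintype.card_fin]
    have h3 : ∏ k, ratioAt t (col (j.succAbove k)) (s (j.succAbove k)) (poleAt t (col j) (u j))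
        (u (j.succAbove k)) = ∏ k ∈ J.erase j, (poleAt t (col j) (u j) - zeroAt t (col k) (u k)) /
          (poleAt t (col j) (u j) - poleAt t (col k) (u k)) := by
      have e1 : J.erase j = (Finset.univ.erase j).filter fun i => s i = col i := by
        rw [hJ, Finset.filter_erase]
      have e2 : Finset.univ.erase j = Finset.univ.map j.succAboveEmb := by
        ext i
        simp [Fin.exists_succAbove_eq_iff]
      rw [e1, Finset.prod_filter, e2, Finset.prod_map]
      rfl
    rw [h2, h3, Fin.prod_univ_succAbove _ j, hj]
    linear_combination (∏ k, scaleWeight b e f t (col (j.succAbove k)) (s (j.succAbove k))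
      (u (j.succAbove k))) * (∏ k ∈ J.erase j, (poleAt t (col j) (u j) - zeroAt t (col k) (u k)) /
          (poleAt t (col j) (u j) - poleAt t (col k) (u k))) *
      h.firstWeight_div_typeWeight (col j) j n
  · rfl

/-- The total of the constant terms of the partial fractions vanishes. -/
theorem sum_scaleWeight {u : Fin (n + 1) → ℂ} (h : IsGeneric a b e f t u)
    (col : Fin (n + 1) → Bool) :
    ∑ s : Fin (n + 1) → Bool, (∏ i, typeWeight a b e f n (s i) (u i)) *
      (∏ p ∈ ltPairs (n + 1), typePair b f t (s p.1) (s p.2) (u p.1) (u p.2)) *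
      ∏ i, scaleWeight b e f t (col i) (s i) (u i) = 0 := by
  rw [← mul_zero ((∏ i, (if col i then e * u i + f else (e * u i + t * f) / t)) *
    ∏ i : Fin (n + 1), (-b)), ← h.sum_typePair_eq_zero, Finset.mul_sum]
  refine Finset.sum_congr rfl fun s _ => ?_
  have : ∀ i, typeWeight a b e f n (s i) (u i) * scaleWeight b e f t (col i) (s i) (u i) =
      (if col i then e * u i + f else (e * u i + t * f) / t) * (-b) *
        (if s i then (a * u i + b) ^ n else -(e * u i + f) ^ n) := by
    intro i
    have hf := h.hf
    cases s i <;> simp only [typeWeight, scaleWeight, if_true, Bool.false_eq_true, if_false]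
    · ring
    · field_simp
  rw [mul_right_comm, ← Finset.prod_mul_distrib, Finset.prod_congr rfl fun i _ => this i,
    Finset.prod_mul_distrib, Finset.prod_mul_distrib]
  ring

/-- The expanded determinant satisfies the recursion of the coloured permutation sum, for every
colouring. -/
theorem typeSum_succ {u : Fin (n + 1) → ℂ} (h : IsGeneric a b e f t u)
    (col : Fin (n + 1) → Bool) :
    ∑ j, firstWeight a b t n (col j) (u j) *
        (∏ k, pairWeight t (col j) (col (j.succAbove k)) (u j) (u (j.succAbove k)) *
          keepWeight e f t (col (j.succAbove k)) (u (j.succAbove k))) *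
        (-(a * f) * typeSum a b e f t (u ∘ j.succAbove)) = typeSum a b e f t u := by
  have key : ∀ j, firstWeight a b t n (col j) (u j) *
        (∏ k, pairWeight t (col j) (col (j.succAbove k)) (u j) (u (j.succAbove k)) *
          keepWeight e f t (col (j.succAbove k)) (u (j.succAbove k))) *
        (-(a * f) * typeSum a b e f t (u ∘ j.succAbove)) =
      ∑ s : Fin (n + 1) → Bool, (if s j = col j then
        (∏ i, typeWeight a b e f n (s i) (u i)) *
        (∏ p ∈ ltPairs (n + 1), typePair b f t (s p.1) (s p.2) (u p.1) (u p.2)) *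
        (-(a * f) * (firstWeight a b t n (col j) (u j) / typeWeight a b e f n (col j) (u j)) *
        ∏ k, (pairWeight t (col j) (col (j.succAbove k)) (u j) (u (j.succAbove k)) *
          keepWeight e f t (col (j.succAbove k)) (u (j.succAbove k)) /
          typePair b f t (col j) (s (j.succAbove k)) (u j) (u (j.succAbove k)))) else 0) := by
    intro j
    -- The variable removed gets the type given by its colour.
    rw [sum_ite_eq_sum_insertNth j (col j), typeSum, Finset.mul_sum, Finset.mul_sum]
    refine Finset.sum_congr rfl fun s _ => ?_
    rw [Fin.prod_univ_succAbove _ j, prod_ltPairs_succAbove (fun i k => typePair b f t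
      ((j.insertNth (col j) s : Fin (n + 1) → Bool) i)
      ((j.insertNth (col j) s : Fin (n + 1) → Bool) k) (u i) (u k))
      (fun _ _ => typePair_comm _ _ _ _ _ _ _) j]
    simp only [Fin.insertNth_apply_same, Fin.insertNth_apply_succAbove, Function.comp]
    rw [Finset.prod_div_distrib]
    have h1 := h.typeWeight_ne_zero n (col j) j
    have h2 : ∏ k, typePair b f t (col j) (s k) (u j) (u (j.succAbove k)) ≠ 0 :=
      Finset.prod_ne_zero_iff.2 fun k _ => h.typePair_ne_zero _ _ (Fin.succAbove_ne j k).symm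
    field_simp
  rw [Finset.sum_congr rfl fun j _ => key j, Finset.sum_comm]
  have hs : ∀ s : Fin (n + 1) → Bool, ∑ j, (if s j = col j then
        (∏ i, typeWeight a b e f n (s i) (u i)) *
        (∏ p ∈ ltPairs (n + 1), typePair b f t (s p.1) (s p.2) (u p.1) (u p.2)) *
        (-(a * f) * (firstWeight a b t n (col j) (u j) / typeWeight a b e f n (col j) (u j)) *
        ∏ k, (pairWeight t (col j) (col (j.succAbove k)) (u j) (u (j.succAbove k)) *
          keepWeight e f t (col (j.succAbove k)) (u (j.succAbove k)) /
          typePair b f t (col j) (s (j.succAbove k)) (u j) (u (j.succAbove k)))) else 0) =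
      (∏ i, typeWeight a b e f (n + 1) (s i) (u i)) *
        (∏ p ∈ ltPairs (n + 1), typePair b f t (s p.1) (s p.2) (u p.1) (u p.2)) -
      (∏ i, typeWeight a b e f n (s i) (u i)) *
        (∏ p ∈ ltPairs (n + 1), typePair b f t (s p.1) (s p.2) (u p.1) (u p.2)) *
        ∏ i, scaleWeight b e f t (col i) (s i) (u i) := by
    intro s
    have hT := congrArg (fun r => (∏ i, typeWeight a b e f n (s i) (u i)) *
      (∏ p ∈ ltPairs (n + 1), typePair b f t (s p.1) (s p.2) (u p.1) (u p.2)) * r)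
      (h.sum_firstWeight col s)
    simp only [Finset.mul_sum, mul_ite, mul_zero] at hT
    rw [hT, ← Finset.prod_congr rfl fun i _ => h.typeWeight_mul_scaleWeight (col i) (s i) i n,
      Finset.prod_mul_distrib, Finset.prod_mul_distrib]
    ring
  rw [Finset.sum_congr rfl fun s _ => hs s, Finset.sum_sub_distrib, h.sum_scaleWeight, sub_zero,
    typeSum]

/-- The value of the coloured permutation sum. It does not depend on the colours. -/
theorem colourSum_mul_preWeight (h : IsGeneric a b e f t u) (col : Fin n → Bool) :
    (-(a * f)) ^ n * (colourSum a b e f t col u * ∏ i, preWeight a b e f t n (col i) (u i)) =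
      typeSum a b e f t u := by
  induction n with
  | zero => simp [colourSum, typeSum, ltPairs]
  | succ n ih =>
    rw [h.colourSum_mul_preWeight_succ, ← h.typeSum_succ col, Finset.mul_sum]
    refine Finset.sum_congr rfl fun j _ => ?_
    rw [← ih (h.comp Fin.succAbove_right_injective) (col ∘ j.succAbove)]
    simp only [Function.comp]
    ring

end IsGeneric

/-! ### The functions `G` and `H` in terms of the coloured weights -/

/-- The sum over permutations common to `symG` (`c = true`) and `symH` (`c = false`). -/
def placementSum (a b e f t : ℂ) (c : Bool) {n : ℕ} (x : Fin n → ℕ) (u : Fin n → ℂ) : ℂ :=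
  ∑ σ : Equiv.Perm (Fin n),
    (∏ p ∈ ltPairs n, pairWeight t c c (u (σ p.1)) (u (σ p.2))) *
      ∏ j, siteWeight a b e f t c (u (σ j)) ^ x j

namespace IsGeneric

variable {a b e f t : ℂ} {n : ℕ} {u : Fin n → ℂ}

theorem symG_eq (h : IsGeneric a b e f t u) (c : ℂ) (M : ℕ) (x : Fin n → ℕ) :
    symG a b c e f t M x u =
      c ^ n * (∏ j, preWeight a b e f t M true (u j)) * placementSum a b e f t true x u := by
  have h1 : ∏ j, (1 - t) * c * u j * (a * u j + b) ^ M / (e * u j + f) =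
      c ^ n * ∏ j, preWeight a b e f t M true (u j) := by
    have hcn : c ^ n = ∏ _j : Fin n, c := by simp
    rw [hcn, ← Finset.prod_mul_distrib]
    exact Finset.prod_congr rfl fun j _ => by simp only [preWeight]; ring
  rw [symG, h1, placementSum, mul_assoc, Finset.mul_sum]
  congr 1
  refine Finset.sum_congr rfl fun σ _ => ?_
  rw [← mul_assoc]
  congr 1
  refine Eq.trans ?_ (prod_ltPairs_mul_prod_inversionPairs
    (fun i j => pairWeight t true true (u i) (u j))
    (fun i j hij => div_ne_zero (h.mul_sub i j hij) (h.sub_ne_zero hij)) σ)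
  congr 1
  refine Finset.prod_congr rfl fun p hp => ?_
  simp only [inversionPairs, Finset.mem_filter, Finset.mem_univ, true_and] at hp
  have hne := h.sub_ne_zero hp.2.ne'
  have hne' := h.mul_sub _ _ hp.2.ne
  have e5 : u (σ p.2) - u (σ p.1) = -(u (σ p.1) - u (σ p.2)) := by ring
  simp only [pairWeight]
  rw [e5]
  field_simp
  ring

theorem symH_eq (h : IsGeneric a b e f t u) (c : ℂ) (M : ℕ) (x : Fin n → ℕ) :
    symH a b c e f t M x u =
      c ^ n * (∏ j, preWeight a b e f t M false (u j)) * placementSum a b e f t false x u := by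
  have h1 : ∏ j, (1 - t) * c * u j * (a * t * u j + b) ^ M / (e * u j + t * f) =
      c ^ n * ∏ j, preWeight a b e f t M false (u j) := by
    have hcn : c ^ n = ∏ _j : Fin n, c := by simp
    rw [hcn, ← Finset.prod_mul_distrib]
    exact Finset.prod_congr rfl fun j _ => by simp only [preWeight]; ring
  have hsub : ∀ i j, i ≠ j → u i - t * u j ≠ 0 := fun i j hij h0 =>
    h.mul_sub j i hij.symm (by linear_combination -h0)
  rw [symH, h1, placementSum, mul_assoc, Finset.mul_sum]
  congr 1
  refine Finset.sum_congr rfl fun σ _ => ?_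
  rw [← mul_assoc]
  congr 1
  refine Eq.trans ?_ (prod_ltPairs_mul_prod_inversionPairs
    (fun i j => pairWeight t false false (u i) (u j))
    (fun i j hij => div_ne_zero (hsub i j hij) (mul_ne_zero h.ht (h.sub_ne_zero hij))) σ)
  congr 1
  refine Finset.prod_congr rfl fun p hp => ?_
  simp only [inversionPairs, Finset.mem_filter, Finset.mem_univ, true_and] at hp
  have hne := h.sub_ne_zero hp.2.ne'
  have hne' := hsub _ _ hp.2.ne
  have ht := h.ht
  have e5 : u (σ p.2) - u (σ p.1) = -(u (σ p.1) - u (σ p.2)) := by ring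
  simp only [pairWeight]
  rw [e5]
  field_simp
  ring

end IsGeneric

/-! ### Configurations and permutations -/

/-- The sites, split into the particles and the holes of a configuration. -/
def siteEquiv {M N : ℕ} (x : ParticleConfig M N) : Fin N ⊕ Fin (M - N) ≃ Fin M :=
  finSumEquivOfFinset x.2 x.holes.2

theorem siteEquiv_inl_add_one {M N : ℕ} (x : ParticleConfig M N) (j : Fin N) :
    (siteEquiv x (Sum.inl j) : ℕ) + 1 = x.pos j := rfl

theorem siteEquiv_inr_add_one {M N : ℕ} (x : ParticleConfig M N) (j : Fin (M - N)) :
    (siteEquiv x (Sum.inr j) : ℕ) + 1 = x.holes.pos j := rfl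

/-- The indices of the variables, split into the last `N` and the first `M - N`. -/
def varEquiv {M N : ℕ} (hN : N ≤ M) : Fin N ⊕ Fin (M - N) ≃ Fin M :=
  Equiv.ofBijective
    (Sum.elim (fun j => ⟨M - N + j.val, by omega⟩) (Fin.castLE (Nat.sub_le M N))) (by
      rw [Fintype.bijective_iff_injective_and_card]
      constructor
      · rintro (i | i) (j | j) h <;> simp [Fin.ext_iff] at h ⊢ <;> omega
      · simp
        omega)

/-- The colour of a variable: `true` for the last `N` variables. -/
def varColour {M N : ℕ} (hN : N ≤ M) (i : Fin M) : Bool := ((varEquiv hN).symm i).isLeft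

/-- The placement of variables on sites given by a configuration and by permutations of the
variables of either colour. -/
def placement {M N : ℕ} (hN : N ≤ M)
    (q : ParticleConfig M N × Equiv.Perm (Fin (M - N)) × Equiv.Perm (Fin N)) :
    Equiv.Perm (Fin M) :=
  (siteEquiv q.1).symm.trans ((Equiv.sumCongr q.2.2 q.2.1).trans (varEquiv hN))

theorem placement_siteEquiv {M N : ℕ} (hN : N ≤ M)
    (q : ParticleConfig M N × Equiv.Perm (Fin (M - N)) × Equiv.Perm (Fin N))
    (y : Fin N ⊕ Fin (M - N)) :
    placement hN q (siteEquiv q.1 y) = varEquiv hN (Sum.map q.2.2 q.2.1 y) := by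
  simp [placement]

theorem placement_injective {M N : ℕ} (hN : N ≤ M) :
    Function.Injective (placement hN) := by
  rintro ⟨x, σ, τ⟩ ⟨x', σ', τ'⟩ h
  have hmem : ∀ (q : ParticleConfig M N × Equiv.Perm (Fin (M - N)) × Equiv.Perm (Fin N))
      (m : Fin M), m ∈ q.1.1 ↔ varColour hN (placement hN q m) = true := by
    intro q m
    obtain ⟨y, rfl⟩ := (siteEquiv q.1).surjective m
    rw [placement_siteEquiv, varColour, Equiv.symm_apply_apply]
    rcases y with j | j
    · exact iff_of_true (Finset.orderEmbOfFin_mem q.1.1 q.1.2 j) (by simp)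
    · exact iff_of_false
        (Finset.mem_compl.1 (Finset.orderEmbOfFin_mem q.1.holes.1 q.1.holes.2 j)) (by simp)
  have hx : x = x' := by
    apply Subtype.ext
    ext m
    rw [hmem ⟨x, σ, τ⟩, hmem ⟨x', σ', τ'⟩, h]
  subst hx
  have hy : ∀ y, Sum.map τ σ y = Sum.map τ' σ' y := by
    intro y
    apply (varEquiv hN).injective
    rw [← placement_siteEquiv hN ⟨x, σ, τ⟩, ← placement_siteEquiv hN ⟨x, σ', τ'⟩, h]
  have h1 : σ = σ' := Equiv.ext fun j => by simpa using hy (Sum.inr j)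
  have h2 : τ = τ' := Equiv.ext fun j => by simpa using hy (Sum.inl j)
  rw [h1, h2]

theorem placement_bijective {M N : ℕ} (hN : N ≤ M) :
    Function.Bijective (placement hN) := by
  rw [Fintype.bijective_iff_injective_and_card]
  refine ⟨placement_injective hN, ?_⟩
  have hc : Fintype.card (ParticleConfig M N) = M.choose N := by
    simp [ParticleConfig]
  rw [Fintype.card_prod, Fintype.card_prod, hc, Fintype.card_perm, Fintype.card_perm,
    Fintype.card_perm, Fintype.card_fin, Fintype.card_fin, Fintype.card_fin,
    ← Nat.choose_mul_factorial_mul_factorial hN]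
  ring

/-- A product over pairs of sites splits along a configuration if the factors of pairs consisting of
a particle and a hole are trivial. -/
theorem prod_ltPairs_siteEquiv {M N : ℕ} (x : ParticleConfig M N) (F : Fin M → Fin M → ℂ)
    (h1 : ∀ i j, F (siteEquiv x (Sum.inl i)) (siteEquiv x (Sum.inr j)) = 1)
    (h2 : ∀ i j, F (siteEquiv x (Sum.inr i)) (siteEquiv x (Sum.inl j)) = 1) :
    ∏ p ∈ ltPairs M, F p.1 p.2 =
      (∏ p ∈ ltPairs N, F (siteEquiv x (Sum.inl p.1)) (siteEquiv x (Sum.inl p.2))) *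
        ∏ p ∈ ltPairs (M - N), F (siteEquiv x (Sum.inr p.1)) (siteEquiv x (Sum.inr p.2)) := by
  rw [prod_ltPairs,
    prod_ltPairs (fun i j => F (siteEquiv x (Sum.inl i)) (siteEquiv x (Sum.inl j))),
    prod_ltPairs (fun i j => F (siteEquiv x (Sum.inr i)) (siteEquiv x (Sum.inr j))),
    ← (siteEquiv x).prod_comp]
  simp only [← Equiv.prod_comp (siteEquiv x) (fun j => if _ < j then F _ j else 1),
    Fintype.prod_sum_type, h1, h2, ite_self, Finset.prod_const_one, mul_one, one_mul]
  have hl : ∀ i j, siteEquiv x (Sum.inl i) < siteEquiv x (Sum.inl j) ↔ i < j := fun _ _ =>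
    (x.1.orderEmbOfFin x.2).lt_iff_lt
  have hr : ∀ i j, siteEquiv x (Sum.inr i) < siteEquiv x (Sum.inr j) ↔ i < j := fun _ _ =>
    (x.holes.1.orderEmbOfFin x.holes.2).lt_iff_lt
  simp only [hl, hr]

/-- The sum over configurations and over permutations of the variables of either colour is a sum
over all placements of the variables. -/
theorem sum_placementSum_mul {M N : ℕ} (hN : N ≤ M) (a b e f t : ℂ) (u : Fin M → ℂ) :
    ∑ x : ParticleConfig M N,
      placementSum a b e f t false x.holes.pos (firstVars N u) *
        placementSum a b e f t true x.pos (lastVars hN u) =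
      colourSum a b e f t (varColour hN) u := by
  rw [colourSum, ← (placement_bijective hN).sum_comp, Fintype.sum_prod_type]
  refine Finset.sum_congr rfl fun x _ => ?_
  rw [placementSum, placementSum, Finset.sum_mul_sum, Fintype.sum_prod_type]
  refine Finset.sum_congr rfl fun σ _ => Finset.sum_congr rfl fun τ _ => ?_
  have hl : ∀ j, placement hN (x, σ, τ) (siteEquiv x (Sum.inl j)) =
      varEquiv hN (Sum.inl (τ j)) := fun j => placement_siteEquiv hN (x, σ, τ) (Sum.inl j)
  have hr : ∀ j, placement hN (x, σ, τ) (siteEquiv x (Sum.inr j)) =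
      varEquiv hN (Sum.inr (σ j)) := fun j => placement_siteEquiv hN (x, σ, τ) (Sum.inr j)
  have cl : ∀ j, varColour hN (varEquiv hN (Sum.inl j)) = true := by simp [varColour]
  have cr : ∀ j, varColour hN (varEquiv hN (Sum.inr j)) = false := by simp [varColour]
  rw [prod_ltPairs_siteEquiv x (fun i j => pairWeight t
      (varColour hN (placement hN (x, σ, τ) i)) (varColour hN (placement hN (x, σ, τ) j))
      (u (placement hN (x, σ, τ) i)) (u (placement hN (x, σ, τ) j)))
      (fun i j => by rw [hl, hr, cl, cr]; rfl) (fun i j => by rw [hl, hr, cl, cr]; rfl),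
    ← Equiv.prod_comp (siteEquiv x), Fintype.prod_sum_type]
  simp only [hl, hr, cl, cr, siteEquiv_inl_add_one, siteEquiv_inr_add_one]
  have vl : ∀ j, u (varEquiv hN (Sum.inl j)) = lastVars hN u j := fun _ => rfl
  have vr : ∀ j, u (varEquiv hN (Sum.inr j)) = firstVars N u j := fun _ => rfl
  simp only [vl, vr]
  ring

theorem lastVars_eq_comp {M N : ℕ} (hN : N ≤ M) (u : Fin M → ℂ) :
    lastVars hN u = u ∘ (varEquiv hN ∘ Sum.inl) := rfl

/-- The pairing formula for generic parameters and variables. -/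
theorem IsGeneric.pairing {M N : ℕ} (hN : N ≤ M) {a b e f t : ℂ} {u : Fin M → ℂ}
    (h : IsGeneric a b e f t u) {c d : ℂ} (h1 : c * d + a * f = 0) (hc : c ≠ 0) (hd : d ≠ 0) :
    ∑ x : ParticleConfig M N,
      symH a b c e f t M x.holes.pos (firstVars N u) *
        symG a b c e f t M x.pos (lastVars hN u) =
    (homogeneousMatrix a b e f u).det /
      (c ^ (M * (M - 1) / 2) * d ^ (M * (M + 1) / 2) *
        ∏ p ∈ ltPairs M, (u p.1 - u p.2)) := by
  have hG : IsGeneric a b e f t (lastVars hN u) :=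
    h.comp ((varEquiv hN).injective.comp Sum.inl_injective)
  have hH : IsGeneric a b e f t (firstVars N u) :=
    h.comp (φ := varEquiv hN ∘ Sum.inr) ((varEquiv hN).injective.comp Sum.inr_injective)
  have hpre : ∏ i, preWeight a b e f t M (varColour hN i) (u i) =
      (∏ j, preWeight a b e f t M true (lastVars hN u j)) *
        ∏ j, preWeight a b e f t M false (firstVars N u j) := by
    rw [← Equiv.prod_comp (varEquiv hN), Fintype.prod_sum_type]
    simp only [varColour, Equiv.symm_apply_apply, Sum.isLeft_inl, Sum.isLeft_inr]
    rfl
  have hcd : -(a * f) = c * d := by linear_combination -h1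
  have hΔ : ∏ p ∈ ltPairs M, (u p.1 - u p.2) ≠ 0 := by
    refine Finset.prod_ne_zero_iff.2 fun p hp => h.sub_ne_zero ?_
    simp only [ltPairs, Finset.mem_filter, Finset.mem_univ, true_and] at hp
    exact hp.ne
  have hexp : M * (M + 1) / 2 = M * (M - 1) / 2 + M := by
    have := Nat.triangle_succ M
    rwa [Nat.add_sub_cancel, mul_comm] at this
  have hcM : c ^ M = c ^ (M - N) * c ^ N := by rw [← pow_add, Nat.sub_add_cancel hN]
  rw [h.det_homogeneousMatrix, ← h.colourSum_mul_preWeight (varColour hN), hcd, hexp, hpre,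
    ← sum_placementSum_mul, pow_add, mul_pow, mul_pow, hcM, Finset.sum_mul, Finset.mul_sum,
    Finset.mul_sum, Finset.sum_div]
  refine Finset.sum_congr rfl fun x _ => ?_
  rw [hG.symG_eq, hH.symH_eq]
  field_simp

/-! ### Passage to the limit -/

section Limit

open Filter Topology

variable {α : Type*} {l : Filter α}

theorem tendsto_symG {a c f b₀ e₀ t₀ : ℂ} {b e t : α → ℂ} (M : ℕ) {n : ℕ} (x : Fin n → ℕ)
    {u : α → Fin n → ℂ} {u₀ : Fin n → ℂ}
    (hb : Tendsto b l (𝓝 b₀)) (he : Tendsto e l (𝓝 e₀)) (ht : Tendsto t l (𝓝 t₀))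
    (hu : ∀ i, Tendsto (fun r => u r i) l (𝓝 (u₀ i))) (hinj : Function.Injective u₀)
    (h1 : ∀ i, a * u₀ i + b₀ ≠ 0) (h2 : ∀ i, e₀ * u₀ i + f ≠ 0)
    (h3 : ∀ i j, i < j → t₀ * u₀ i - u₀ j ≠ 0) :
    Tendsto (fun r => symG a (b r) c (e r) f (t r) M x (u r)) l
      (𝓝 (symG a b₀ c e₀ f t₀ M x u₀)) := by
  have hp : ∀ i, Tendsto (fun r => a * u r i + b r) l (𝓝 (a * u₀ i + b₀)) :=
    fun i => ((hu i).const_mul a).add hb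
  have hq : ∀ i, Tendsto (fun r => e r * u r i + f) l (𝓝 (e₀ * u₀ i + f)) :=
    fun i => (he.mul (hu i)).add_const f
  unfold symG
  refine ((tendsto_finsetProd _ fun i _ => ?_).mul (tendsto_finsetProd _ fun p hp => ?_)).mul
    (tendsto_finsetSum _ fun σ _ => (tendsto_finsetProd _ fun p hp => ?_).mul
      (tendsto_finsetProd _ fun i _ => ?_))
  · exact ((((ht.const_sub 1).mul_const c).mul (hu i)).mul ((hp i).pow M)).div (hq i) (h2 i)
  · simp only [ltPairs, Finset.mem_filter, Finset.mem_univ, true_and] at hp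
    exact ((ht.mul (hu _)).sub (hu _)).div ((hu _).sub (hu _)) (sub_ne_zero.2 (hinj.ne hp.ne))
  · simp only [inversionPairs, Finset.mem_filter, Finset.mem_univ, true_and] at hp
    exact ((hu _).sub (ht.mul (hu _))).div ((ht.mul (hu _)).sub (hu _)) (h3 _ _ hp.2)
  · exact ((hq _).div (hp _) (h1 _)).pow _

theorem tendsto_symH {a c f b₀ e₀ t₀ : ℂ} {b e t : α → ℂ} (M : ℕ) {n : ℕ} (x : Fin n → ℕ)
    {u : α → Fin n → ℂ} {u₀ : Fin n → ℂ}
    (hb : Tendsto b l (𝓝 b₀)) (he : Tendsto e l (𝓝 e₀)) (ht : Tendsto t l (𝓝 t₀))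
    (hu : ∀ i, Tendsto (fun r => u r i) l (𝓝 (u₀ i)))
    (h1 : ∀ i, a * t₀ * u₀ i + b₀ ≠ 0) (h2 : ∀ i, e₀ * u₀ i + t₀ * f ≠ 0)
    (h3 : ∀ i j, i < j → t₀ * (u₀ i - u₀ j) ≠ 0)
    (h4 : ∀ i j, i < j → u₀ i - t₀ * u₀ j ≠ 0) :
    Tendsto (fun r => symH a (b r) c (e r) f (t r) M x (u r)) l
      (𝓝 (symH a b₀ c e₀ f t₀ M x u₀)) := by
  have hp : ∀ i, Tendsto (fun r => a * t r * u r i + b r) l (𝓝 (a * t₀ * u₀ i + b₀)) :=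
    fun i => ((ht.const_mul a).mul (hu i)).add hb
  have hq : ∀ i, Tendsto (fun r => e r * u r i + t r * f) l (𝓝 (e₀ * u₀ i + t₀ * f)) :=
    fun i => (he.mul (hu i)).add (ht.mul_const f)
  unfold symH
  refine ((tendsto_finsetProd _ fun i _ => ?_).mul (tendsto_finsetProd _ fun p hp => ?_)).mul
    (tendsto_finsetSum _ fun σ _ => (tendsto_finsetProd _ fun p hp => ?_).mul
      (tendsto_finsetProd _ fun i _ => ?_))
  · exact ((((ht.const_sub 1).mul_const c).mul (hu i)).mul ((hp i).pow M)).div (hq i) (h2 i)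
  · simp only [ltPairs, Finset.mem_filter, Finset.mem_univ, true_and] at hp
    exact ((hu _).sub (ht.mul (hu _))).div (ht.mul ((hu _).sub (hu _))) (h3 _ _ hp)
  · simp only [inversionPairs, Finset.mem_filter, Finset.mem_univ, true_and] at hp
    exact ((ht.mul (hu _)).sub (hu _)).div ((hu _).sub (ht.mul (hu _))) (h4 _ _ hp.2)
  · exact ((hq _).div (hp _) (h1 _)).pow _

/-- A nonzero polynomial has no zeros in a punctured neighbourhood of `0`. -/
theorem eventually_eval_ne_zero {P : Polynomial ℂ} (hP : P ≠ 0) :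
    ∀ᶠ ε in 𝓝[≠] (0 : ℂ), P.eval ε ≠ 0 := by
  have h1 : ((P.roots.toFinset : Set ℂ) \ {0}).Finite :=
    (Finset.finite_toSet _).subset Set.sdiff_subset
  have h2 : ((P.roots.toFinset : Set ℂ) \ {0})ᶜ ∈ 𝓝 (0 : ℂ) :=
    h1.isClosed.isOpen_compl.mem_nhds (by simp)
  filter_upwards [mem_nhdsWithin_of_mem_nhds h2, self_mem_nhdsWithin] with ε hε hε0 h0
  exact hε ⟨by simpa [hP] using h0, hε0⟩

/-- Shifting `b`, `e` and all variables by a small `ε ≠ 0`, with `t` adjusted to keep the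
constraint, leads to generic parameters and variables. -/
theorem eventually_isGeneric {M N : ℕ} (hN : N ≤ M) {a b c d e f t : ℂ}
    (h1 : c * d + a * f = 0) (h2 : t * c * d + b * e = 0) (hc : c ≠ 0) (hd : d ≠ 0)
    {u : Fin M → ℂ} (hu : Function.Injective u)
    (hH1 : ∀ i, a * t * firstVars N u i + b ≠ 0)
    (hH2 : ∀ i, e * firstVars N u i + t * f ≠ 0)
    (hG1 : ∀ i, a * lastVars hN u i + b ≠ 0)
    (hG2 : ∀ i, e * lastVars hN u i + f ≠ 0) :
    ∀ᶠ ε in 𝓝[≠] (0 : ℂ),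
      IsGeneric a (b + ε) (e + ε) f (-((b + ε) * (e + ε)) / (c * d)) fun i => u i + ε := by
  have hcd : c * d ≠ 0 := mul_ne_zero hc hd
  have ht0 : t = -(b * e) / (c * d) := by
    rw [eq_div_iff hcd]
    linear_combination h2
  have hb : ∀ᶠ ε in 𝓝[≠] (0 : ℂ), b + ε ≠ 0 := by
    simpa [add_comm] using eventually_eval_ne_zero (Polynomial.X_add_C_ne_zero b)
  have he : ∀ᶠ ε in 𝓝[≠] (0 : ℂ), e + ε ≠ 0 := by
    simpa [add_comm] using eventually_eval_ne_zero (Polynomial.X_add_C_ne_zero e)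
  have hmul : ∀ᶠ ε in 𝓝[≠] (0 : ℂ), ∀ i j, i ≠ j →
      -((b + ε) * (e + ε)) / (c * d) * (u i + ε) - (u j + ε) ≠ 0 := by
    simp only [eventually_all]
    intro i j hij
    -- Up to the factor `-(c * d)`, the expression is a cubic polynomial in `ε`; it is not zero since
    -- its value at `-u i` is `c * d * (u j - u i)`.
    let P : Polynomial ℂ := (Polynomial.X + Polynomial.C b) * (Polynomial.X + Polynomial.C e) *
      (Polynomial.X + Polynomial.C (u i)) +
        Polynomial.C (c * d) * (Polynomial.X + Polynomial.C (u j))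
    have hP : P ≠ 0 := by
      intro h0
      have h := congrArg (Polynomial.eval (-u i)) h0
      simp only [P, Polynomial.eval_add, Polynomial.eval_mul, Polynomial.eval_X,
        Polynomial.eval_C, Polynomial.eval_zero] at h
      have h' : c * d * (u j - u i) = 0 := by linear_combination h
      exact mul_ne_zero hcd (sub_ne_zero.2 (hu.ne hij.symm)) h'
    filter_upwards [eventually_eval_ne_zero hP] with ε hε h0
    apply hε
    simp only [P, Polynomial.eval_add, Polynomial.eval_mul, Polynomial.eval_X, Polynomial.eval_C]
    field_simp at h0
    linear_combination -h0
  have hcont : ∀ {g : ℂ → ℂ}, Continuous g → g 0 ≠ 0 → ∀ᶠ ε in 𝓝[≠] (0 : ℂ), g ε ≠ 0 :=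
    fun hg h0 => (hg.continuousAt.eventually_ne h0).filter_mono nhdsWithin_le_nhds
  have e1 : ∀ᶠ ε in 𝓝[≠] (0 : ℂ), ∀ i,
      a * (-((b + ε) * (e + ε)) / (c * d)) * (firstVars N u i + ε) + (b + ε) ≠ 0 :=
    eventually_all.2 fun i => hcont (by fun_prop) (by simpa [← ht0] using hH1 i)
  have e2 : ∀ᶠ ε in 𝓝[≠] (0 : ℂ), ∀ i,
      (e + ε) * (firstVars N u i + ε) + -((b + ε) * (e + ε)) / (c * d) * f ≠ 0 :=
    eventually_all.2 fun i => hcont (by fun_prop) (by simpa [← ht0] using hH2 i)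
  have e3 : ∀ᶠ ε in 𝓝[≠] (0 : ℂ), ∀ i, a * (lastVars hN u i + ε) + (b + ε) ≠ 0 :=
    eventually_all.2 fun i => hcont (by fun_prop) (by simpa using hG1 i)
  have e4 : ∀ᶠ ε in 𝓝[≠] (0 : ℂ), ∀ i, (e + ε) * (lastVars hN u i + ε) + f ≠ 0 :=
    eventually_all.2 fun i => hcont (by fun_prop) (by simpa using hG2 i)
  filter_upwards [hb, he, hmul, e1, e2, e3, e4] with ε hb he hmul e1 e2 e3 e4
  set s := -((b + ε) * (e + ε)) / (c * d) with hs
  have hrel : (b + ε) * (e + ε) = s * a * f := by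
    have : s * (c * d) = -((b + ε) * (e + ε)) := by rw [hs, div_mul_cancel₀ _ hcd]
    linear_combination this - s * h1
  refine ⟨hrel, hb, he, fun i j h => hu (add_right_cancel h), fun i => ?_, fun i => ?_, hmul⟩
  -- For the variables of `H`, the denominators of `G` agree with those of `H` up to a factor.
  · obtain ⟨y | y, rfl⟩ := (varEquiv hN).surjective i
    · exact e3 y
    · intro h0
      refine e2 y ((mul_eq_zero.1 (?_ : (b + ε) * _ = 0)).resolve_left hb)
      have h0' : a * (firstVars N u y + ε) + (b + ε) = 0 := h0
      linear_combination s * f * h0' + (firstVars N u y + ε) * hrel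
  · obtain ⟨y | y, rfl⟩ := (varEquiv hN).surjective i
    · exact e4 y
    · intro h0
      have h0' : (e + ε) * (firstVars N u y + ε) + f = 0 := h0
      have hf : f ≠ 0 := right_ne_zero_of_mul (hrel ▸ mul_ne_zero hb he)
      refine e1 y ((mul_eq_zero.1 (?_ : f * _ = 0)).resolve_left hf)
      linear_combination (b + ε) * h0' - (firstVars N u y + ε) * hrel

end Limit

theorem mainTheorem5 (M N : ℕ) (hN : N ≤ M) (a b c d e f t : ℂ)
    -- the constraints on the parameters of the six-vertex model
    (h1 : c * d + a * f = 0) (h2 : t * c * d + b * e = 0)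
    (hc : c ≠ 0) (hd : d ≠ 0)
    (u : Fin M → ℂ) (hu : Function.Injective u)
    -- the denominators in the definition of `H` do not vanish at `u₁, …, u_{M-N}`
    (hH1 : ∀ i, a * t * firstVars N u i + b ≠ 0)
    (hH2 : ∀ i, e * firstVars N u i + t * f ≠ 0)
    (hH3 : ∀ i j, i < j → t * (firstVars N u i - firstVars N u j) ≠ 0)
    (hH4 : ∀ i j, i < j → firstVars N u i - t * firstVars N u j ≠ 0)
    -- the denominators in the definition of `G` do not vanish at `u_{M-N+1}, …, u_M`
    (hG1 : ∀ i, a * lastVars hN u i + b ≠ 0)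
    (hG2 : ∀ i, e * lastVars hN u i + f ≠ 0)
    (hG3 : ∀ i j, i < j → t * lastVars hN u i - lastVars hN u j ≠ 0) :
    ∑ x : ParticleConfig M N,
      symH a b c e f t M x.holes.pos (firstVars N u) *
        symG a b c e f t M x.pos (lastVars hN u) =
    (homogeneousMatrix a b e f u).det /
      (c ^ (M * (M - 1) / 2) * d ^ (M * (M + 1) / 2) *
        ∏ p ∈ ltPairs M, (u p.1 - u p.2)) := by
  have hcd : c * d ≠ 0 := mul_ne_zero hc hd
  have ht0 : t = -(b * e) / (c * d) := by
    rw [eq_div_iff hcd]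
    linear_combination h2
  have tb : Filter.Tendsto (fun ε : ℂ => b + ε) (nhdsWithin 0 {0}ᶜ) (nhds b) :=
    ((by fun_prop : Continuous fun ε : ℂ => b + ε).tendsto' 0 b (by simp)).mono_left
      nhdsWithin_le_nhds
  have te : Filter.Tendsto (fun ε : ℂ => e + ε) (nhdsWithin 0 {0}ᶜ) (nhds e) :=
    ((by fun_prop : Continuous fun ε : ℂ => e + ε).tendsto' 0 e (by simp)).mono_left
      nhdsWithin_le_nhds
  have tt : Filter.Tendsto (fun ε : ℂ => -((b + ε) * (e + ε)) / (c * d))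
      (nhdsWithin 0 {0}ᶜ) (nhds t) :=
    ht0 ▸ (tb.mul te).neg.div_const _
  have tu : ∀ i, Filter.Tendsto (fun ε : ℂ => u i + ε) (nhdsWithin 0 {0}ᶜ) (nhds (u i)) := fun i =>
    ((by fun_prop : Continuous fun ε : ℂ => u i + ε).tendsto' 0 (u i) (by simp)).mono_left
      nhdsWithin_le_nhds
  have hinj : Function.Injective (lastVars hN u) := by
    rw [lastVars_eq_comp]
    exact hu.comp ((varEquiv hN).injective.comp Sum.inl_injective)
  have hleft := tendsto_finsetSum (Finset.univ : Finset (ParticleConfig M N)) fun x _ =>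
    (tendsto_symH (c := c) (u := fun ε : ℂ => firstVars N fun i => u i + ε) M x.holes.pos tb te tt
      (fun i => tu _) hH1 hH2 hH3 hH4).mul
    (tendsto_symG (c := c) (u := fun ε : ℂ => lastVars hN fun i => u i + ε) M x.pos tb te tt
      (fun i => tu _) hinj hG1 hG2 hG3)
  have hdet : Continuous fun ε : ℂ =>
      (homogeneousMatrix a (b + ε) (e + ε) f fun i => u i + ε).det := by
    refine Continuous.matrix_det (continuous_matrix fun i k => ?_)
    simp only [homogeneousMatrix, Matrix.of_apply]
    fun_prop
  have hright : Filter.Tendsto (fun ε : ℂ =>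
      (homogeneousMatrix a (b + ε) (e + ε) f fun i => u i + ε).det /
      (c ^ (M * (M - 1) / 2) * d ^ (M * (M + 1) / 2) *
        ∏ p ∈ ltPairs M, ((u p.1 + ε) - (u p.2 + ε)))) (nhdsWithin 0 {0}ᶜ)
      (nhds ((homogeneousMatrix a b e f u).det / (c ^ (M * (M - 1) / 2) * d ^ (M * (M + 1) / 2) *
        ∏ p ∈ ltPairs M, (u p.1 - u p.2)))) := by
    simp only [add_sub_add_right_eq_sub]
    exact ((hdet.tendsto' 0 _ (by simp)).mono_left nhdsWithin_le_nhds).div_const _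
  refine tendsto_nhds_unique (hleft.congr' ?_) hright
  filter_upwards [eventually_isGeneric hN h1 h2 hc hd hu hH1 hH2 hG1 hG2] with ε hε
  exact hε.pairing hN h1 hc hd

end
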